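/- Let $K_q$ denote the complete graph on $q$ vertices. The direct product $G\times H$ of simple graphs $G$ and $H$ has vertex set $V(G)\times V(H)$, with $(u_1,u_2)$ and $(v_1,v_2)$ adjacent if and only if $u_1v_1\in E(G)$ and $u_2v_2\in E(H)$. For a finite simple graph $G=(V,E)$, a nonempty set $C\subseteq V$ is called a locating-dominating code if, writing $I(u)=N[u]\cap C$ with $N[u]$ the closed neighbourhood of $u$, we have $I(u)\neq\emptyset$ for every $u\in V\setminus C$ and $I(u)\neq I(v)$ for all distinct $u,v\in V\setminus C$. Let $\gamma^{LD}(G)$ be the smallest cardinality of a locating-dominating code in $G$. Theorem. For all integers $2\le n\le m$, $$\gamma^{LD}(K_n\times K_m)=\begin{cases} m-1, & 2n\le m \text{ and } (n,m)\neq(2,4),\\ \left\lceil\dfrac{2n+2m-1}{3}\right\rceil-1, & 2<n\le m<2n \text{ and } (n,m)\neq(4,4),\\ m, & n=2 \text{ and } m\le 4,\\ 5, & n=m=4. \end{cases}$$ -/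

import Mathlib

namespace SimpleGraph

/-- The direct (tensor) product `G × H` of two simple graphs: `(u₁, u₂)` and `(v₁, v₂)` are
adjacent if and only if `u₁ v₁` is an edge of `G` and `u₂ v₂` is an edge of `H`. -/
def directProd {V W : Type*} (G : SimpleGraph V) (H : SimpleGraph W) : SimpleGraph (V × W) where
  Adj x y := G.Adj x.1 y.1 ∧ H.Adj x.2 y.2
  symm := ⟨fun _ _ h => ⟨h.1.symm, h.2.symm⟩⟩
  loopless := ⟨fun x h => G.loopless.irrefl x.1 h.1⟩

/-- The closed neighbourhood `N[v] = N(v) ∪ {v}`. -/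
def closedNeighborSet {V : Type*} (G : SimpleGraph V) (v : V) : Set V :=
  G.neighborSet v ∪ {v}

/-- The identifying set `I(C; v) = N[v] ∩ C` of a vertex `v` with respect to `C`. -/
def iSet {V : Type*} (G : SimpleGraph V) (C : Set V) (v : V) : Set V :=
  G.closedNeighborSet v ∩ C

/-- A code is a nonempty set `C` of vertices. It is locating-dominating if the vertices outside `C`
have nonempty and pairwise distinct identifying sets. -/
structure IsLocatingDominating {V : Type*} (G : SimpleGraph V) (C : Set V) : Prop where
  nonempty : C.Nonempty
  dominating : ∀ u, u ∉ C → (G.iSet C u).Nonempty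
  locating : ∀ u v, u ∉ C → v ∉ C → u ≠ v → G.iSet C u ≠ G.iSet C v

/-- The smallest cardinality `γ^LD(G)` of a locating-dominating code in a finite graph. -/
noncomputable def locatingDominationNumber {V : Type*} [Fintype V] (G : SimpleGraph V) : ℕ :=
  sInf {k : ℕ | ∃ C : Finset V, G.IsLocatingDominating (C : Set V) ∧ C.card = k}

/-- The set of all vertices is a locating-dominating code, so that the infimum defining
`locatingDominationNumber` is a minimum: an optimal code exists. -/
theorem isLeast_locatingDominationNumber {V : Type*} [Fintype V] [Nonempty V]
    (G : SimpleGraph V) :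
    IsLeast {k : ℕ | ∃ C : Finset V, G.IsLocatingDominating (C : Set V) ∧ C.card = k}
      G.locatingDominationNumber := by
  have hne : {k : ℕ | ∃ C : Finset V,
      G.IsLocatingDominating (C : Set V) ∧ C.card = k}.Nonempty := by
    refine ⟨_, Finset.univ, ⟨?_, ?_, ?_⟩, rfl⟩
    · simp
    · intro u hu
      simp at hu
    · intro u v hu
      simp at hu
  exact ⟨Nat.sInf_mem hne, fun k hk => Nat.sInf_le hk⟩

end SimpleGraph

/-!
The vertices of `K_n × K_m` are the cells of an `n × m` board, and a cell `(r, c)` outside a code `C`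
is identified by the code cells that avoid row `r` and column `c`. Read `C` as the edge set of a
bipartite graph between rows and columns. Then `C` separates the cells outside it exactly when at
most one row and at most one column are empty and no two disjoint pairs (row, column) are matched,
where a pair is matched if both of its lines are empty or if it is an isolated edge (`Matched`).

*Lower bounds.* At most one column is empty, hence `m - 1 ≤ #C`. In addition each code cell gives
each of its two lines share `1`, or share `2` if it is alone on that line. A nonempty line receives
at least `2`, and a cell gives at most `3` unless it is an isolated edge. Since the matched pairs
restrict the empty lines and the isolated edges, `2n + 2m ≤ 3 #C + 4`
(`IsLocatingDominating.two_mul_card_add_card_le`). In the exceptional cases `n = 2 ≤ m ≤ 4` and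
`n = m = 4` a code attaining these bounds would leave some cell undominated
(`IsLocatingDominating.le_card_of_two_rows`, `IsLocatingDominating.five_le_card`).

*Constructions.* The bounds are attained by forests of stars. If `2n ≤ m`, every row is the centre
of a star, with two leaves except in the last row (`locatingDominationNumber_le_sub_one`). If
`m < 2n`, there are stars with two leaves centred in rows and in columns, and possibly one isolated
edge (`locatingDominationNumber_le_of_stars`). Such a forest dominates as soon as it has three
components; the smaller boards are treated by explicit codes.
-/

open Finset

namespace SimpleGraph

/-! ### Codes in a product of complete graphs -/

section Criterion

variable {α β : Type*}

/-- The direct product of the complete graphs on `α` and `β`: two cells of the `α × β` board are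
adjacent when they share neither a row nor a column. -/
abbrev completeProd (α β : Type*) : SimpleGraph (α × β) :=
  (completeGraph α).directProd (completeGraph β)

theorem mem_iSet_completeProd {C : Set (α × β)} {u p : α × β} (hu : u ∉ C) :
    p ∈ (completeProd α β).iSet C u ↔ p ∈ C ∧ p.1 ≠ u.1 ∧ p.2 ≠ u.2 := by
  have : p = u → p ∉ C := by rintro rfl; exact hu
  simp only [iSet, closedNeighborSet, Set.mem_inter_iff, Set.mem_union, mem_neighborSet,
    Set.mem_singleton_iff, directProd, completeGraph, top_adj]
  grind

theorem isLocatingDominating_completeProd_iff {C : Set (α × β)} :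
    (completeProd α β).IsLocatingDominating C ↔
      C.Nonempty ∧ (∀ u, u ∉ C → ∃ p ∈ C, p.1 ≠ u.1 ∧ p.2 ≠ u.2) ∧
      ∀ u v, u ∉ C → v ∉ C → u ≠ v →
        ∃ p ∈ C, ¬ ((p.1 ≠ u.1 ∧ p.2 ≠ u.2) ↔ (p.1 ≠ v.1 ∧ p.2 ≠ v.2)) := by
  have key : ∀ u v, u ∉ C → v ∉ C →
      ((completeProd α β).iSet C u ≠ (completeProd α β).iSet C v ↔
        ∃ p ∈ C, ¬ ((p.1 ≠ u.1 ∧ p.2 ≠ u.2) ↔ (p.1 ≠ v.1 ∧ p.2 ≠ v.2))) := by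
    intro u v hu hv
    rw [Ne, Set.ext_iff, not_forall]
    refine exists_congr fun p => ?_
    rw [mem_iSet_completeProd hu, mem_iSet_completeProd hv]
    tauto
  constructor
  · rintro ⟨h1, h2, h3⟩
    refine ⟨h1, fun u hu => ?_, fun u v hu hv huv => (key u v hu hv).1 (h3 u v hu hv huv)⟩
    obtain ⟨p, hp⟩ := h2 u hu
    exact ⟨p, (mem_iSet_completeProd hu).1 hp⟩
  · rintro ⟨h1, h2, h3⟩
    refine ⟨h1, fun u hu => ?_, fun u v hu hv huv => (key u v hu hv).2 (h3 u v hu hv huv)⟩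
    obtain ⟨p, hp⟩ := h2 u hu
    exact ⟨p, (mem_iSet_completeProd hu).2 hp⟩

/-- Row `r` and column `c` are matched by `C` when the code cells in row `r` are the code cells in
column `c`. Either both lines are empty, or `(r, c)` is the only code cell on each of them. -/
def Matched (C : Set (α × β)) (r : α) (c : β) : Prop :=
  ∀ p ∈ C, p.1 = r ↔ p.2 = c

variable {C : Set (α × β)}

theorem isLocatingDominating_completeProd_of (hne : C.Nonempty)
    (hdom : ∀ u, u ∉ C → ∃ p ∈ C, p.1 ≠ u.1 ∧ p.2 ≠ u.2)
    (hrow : ∀ r r', (∀ p ∈ C, p.1 ≠ r) → (∀ p ∈ C, p.1 ≠ r') → r = r')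
    (hcol : ∀ c c', (∀ p ∈ C, p.2 ≠ c) → (∀ p ∈ C, p.2 ≠ c') → c = c')
    (hmatch : ∀ r r' c c', Matched C r c' → Matched C r' c → r = r' ∨ c = c') :
    (completeProd α β).IsLocatingDominating C := by
  refine isLocatingDominating_completeProd_iff.2 ⟨hne, hdom, ?_⟩
  rintro ⟨r, c⟩ ⟨r', c'⟩ hu hv huv
  by_contra! h
  simp only at h
  -- a code cell sharing a line with one of the two cells shares a line with the other
  by_cases hr : r = r'
  · subst hr
    exact huv (by rw [hcol c c' (by grind) (by grind)])
  by_cases hc : c = c'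
  · subst hc
    exact huv (by rw [hrow r r' (by grind) (by grind)])
  have h1 : Matched C r c' := by unfold Matched; grind
  have h2 : Matched C r' c := by unfold Matched; grind
  exact (hmatch r r' c c' h1 h2).elim hr hc

theorem IsLocatingDominating.row_eq [Nonempty β]
    (hC : (completeProd α β).IsLocatingDominating C) {r r' : α}
    (hr : ∀ p ∈ C, p.1 ≠ r) (hr' : ∀ p ∈ C, p.1 ≠ r') : r = r' := by
  by_contra hne
  obtain ⟨c⟩ := ‹Nonempty β›
  obtain ⟨p, hp, h⟩ := (isLocatingDominating_completeProd_iff.1 hC).2.2 (r, c) (r', c)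
    (fun h => hr _ h rfl) (fun h => hr' _ h rfl) (by simpa using hne)
  have := hr p hp
  have := hr' p hp
  tauto

theorem IsLocatingDominating.col_eq [Nonempty α]
    (hC : (completeProd α β).IsLocatingDominating C) {c c' : β}
    (hc : ∀ p ∈ C, p.2 ≠ c) (hc' : ∀ p ∈ C, p.2 ≠ c') : c = c' := by
  by_contra hne
  obtain ⟨r⟩ := ‹Nonempty α›
  obtain ⟨p, hp, h⟩ := (isLocatingDominating_completeProd_iff.1 hC).2.2 (r, c) (r, c')
    (fun h => hc _ h rfl) (fun h => hc' _ h rfl) (by simpa using hne)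
  have := hc p hp
  have := hc' p hp
  tauto

/-- Two matched pairs `(r, c')` and `(r', c)` share a line: otherwise the cells `(r, c)` and
`(r', c')` lie outside the code and have the same identifying set. -/
theorem IsLocatingDominating.matched
    (hC : (completeProd α β).IsLocatingDominating C) {r r' : α} {c c' : β}
    (h : Matched C r c') (h' : Matched C r' c) : r = r' ∨ c = c' := by
  by_contra! hne
  obtain ⟨p, hp, hp'⟩ := (isLocatingDominating_completeProd_iff.1 hC).2.2 (r, c) (r', c')
    (fun hm => hne.2 ((h _ hm).1 rfl)) (fun hm => hne.2 ((h' _ hm).1 rfl).symm)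
    (by simp [hne.1])
  have := h p hp
  have := h' p hp
  tauto

end Criterion

/-! ### Lower bounds -/

section LowerBound

theorem card_le_card_add_card_empty_fibers {ι α : Type*} [Fintype α] [DecidableEq α]
    (C : Finset ι) (f : ι → α) :
    Fintype.card α ≤ #C + #{a | #{p ∈ C | f p = a} = 0} := by
  rw [card_eq_sum_card_fiberwise (f := f) (t := univ) (s := C) (by simp), card_filter,
    ← sum_add_distrib, ← card_univ, card_eq_sum_ones]
  refine sum_le_sum fun a _ => ?_
  split_ifs <;> omega

theorem card_add_card_fiber_le {ι α : Type*} [Fintype α] [DecidableEq α]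
    (C : Finset ι) (f : ι → α) (a : α) :
    Fintype.card α + #{p ∈ C | f p = a} ≤ #C + #{a | #{p ∈ C | f p = a} = 0} + 1 := by
  have h : ∑ b, (1 + if b = a then #{p ∈ C | f p = a} else 0) ≤
      ∑ b, ((#{p ∈ C | f p = b} + if #{p ∈ C | f p = b} = 0 then 1 else 0) +
        if b = a then 1 else 0) := by
    refine sum_le_sum fun b _ => ?_
    by_cases hb : b = a
    · subst hb
      simp only [if_true]
      split_ifs <;> omega
    · simp only [hb, if_false]
      split_ifs <;> omega
  rw [sum_add_distrib, sum_add_distrib, sum_add_distrib, sum_ite_eq' univ a, sum_ite_eq' univ a,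
    if_pos (mem_univ a), if_pos (mem_univ a), ← card_filter,
    ← card_eq_sum_card_fiberwise (f := f) (t := univ) (s := C) (by simp), ← card_eq_sum_ones,
    card_univ] at h
  exact h

/-- If there are as many code cells as lines and some line is empty, another line contains two. -/
theorem exists_one_lt_card_fiber {ι α : Type*} [Fintype α] [DecidableEq α]
    {C : Finset ι} {f : ι → α} (hC : Fintype.card α ≤ #C)
    (hf : 0 < #{a | #{p ∈ C | f p = a} = 0}) : ∃ a, 1 < #{p ∈ C | f p = a} := by
  obtain ⟨a, ha⟩ := card_pos.1 hf
  have ha := (mem_filter.1 ha).2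
  rw [card_eq_zero, filter_eq_empty_iff] at ha
  have hpos : 0 < Fintype.card α := Fintype.card_pos_iff.2 ⟨a⟩
  obtain ⟨b, -, hb⟩ := exists_lt_card_fiber_of_mul_lt_card_of_maps_to (s := C) (f := f)
    (t := univ.erase a) (n := 1) (fun p hp => mem_erase.2 ⟨ha hp, mem_univ _⟩) (by
      rw [card_erase_of_mem (mem_univ a), card_univ]
      omega)
  exact ⟨b, hb⟩

/-- The share that a code cell gives to a line through it: `2` if it is the only code cell on that
line, `1` otherwise. -/
def share {ι α : Type*} [DecidableEq α] (C : Finset ι) (f : ι → α) (p : ι) : ℕ :=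
  if #{q ∈ C | f q = f p} = 1 then 2 else 1

/-- Each nonempty line receives total share at least `2`. -/
theorem two_mul_card_le_sum_share {ι α : Type*} [Fintype α] [DecidableEq α]
    (C : Finset ι) (f : ι → α) :
    2 * Fintype.card α ≤ ∑ p ∈ C, share C f p + 2 * #{a | #{p ∈ C | f p = a} = 0} := by
  rw [← sum_fiberwise C f, card_filter, mul_sum, ← sum_add_distrib, ← card_univ,
    card_eq_sum_ones, mul_sum]
  refine sum_le_sum fun a _ => ?_
  have : ∑ p ∈ C with f p = a, share C f p =
      #{p ∈ C | f p = a} * (if #{p ∈ C | f p = a} = 1 then 2 else 1) := by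
    rw [← smul_eq_mul, ← sum_const]
    refine sum_congr rfl fun p hp => ?_
    rw [share, (mem_filter.1 hp).2]
  rw [this]
  split_ifs <;> omega

theorem card_fiber_eq_zero {ι γ : Type*} [DecidableEq γ] {C : Finset ι} {f : ι → γ} {a : γ} :
    #{p ∈ C | f p = a} = 0 ↔ ∀ p ∈ (C : Set ι), f p ≠ a := by
  rw [card_eq_zero, filter_eq_empty_iff]
  simp

theorem IsLocatingDominating.card_empty_rows_le {α β : Type*} [Fintype α] [DecidableEq α]
    [Nonempty β] {C : Finset (α × β)}
    (hC : (completeProd α β).IsLocatingDominating (C : Set (α × β))) :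
    #{a | #{p ∈ C | p.1 = a} = 0} ≤ 1 := by
  rw [card_le_one]
  intro a ha b hb
  exact hC.row_eq (card_fiber_eq_zero.1 (mem_filter.1 ha).2)
    (card_fiber_eq_zero.1 (mem_filter.1 hb).2)

theorem IsLocatingDominating.card_empty_cols_le {α β : Type*} [Fintype β] [DecidableEq β]
    [Nonempty α] {C : Finset (α × β)}
    (hC : (completeProd α β).IsLocatingDominating (C : Set (α × β))) :
    #{b | #{p ∈ C | p.2 = b} = 0} ≤ 1 := by
  rw [card_le_one]
  intro a ha b hb
  exact hC.col_eq (card_fiber_eq_zero.1 (mem_filter.1 ha).2)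
    (card_fiber_eq_zero.1 (mem_filter.1 hb).2)

theorem IsLocatingDominating.card_le_card_add_one {α β : Type*} [Fintype β] [DecidableEq β]
    [Nonempty α] {C : Finset (α × β)}
    (hC : (completeProd α β).IsLocatingDominating (C : Set (α × β))) :
    Fintype.card β ≤ #C + 1 := by
  have h1 := card_le_card_add_card_empty_fibers C (Prod.snd : α × β → β)
  have h2 := hC.card_empty_cols_le
  omega

variable {α β : Type*} [DecidableEq α] [DecidableEq β]

/-- The shares given by a code cell add up to `3`, increased by `1` if the cell is alone on both of
its lines and decreased by `1` if it is alone on neither. -/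
theorem sum_share_add_sum_share (C : Finset (α × β)) :
    ∑ p ∈ C, share C Prod.fst p + ∑ p ∈ C, share C Prod.snd p +
        #{p ∈ C | #{q ∈ C | q.1 = p.1} ≠ 1 ∧ #{q ∈ C | q.2 = p.2} ≠ 1} =
      3 * #C + #{p ∈ C | #{q ∈ C | q.1 = p.1} = 1 ∧ #{q ∈ C | q.2 = p.2} = 1} := by
  rw [card_filter, card_filter, card_eq_sum_ones, mul_sum, ← sum_add_distrib, ← sum_add_distrib,
    ← sum_add_distrib]
  refine sum_congr rfl fun p _ => ?_
  unfold share
  split_ifs <;> omega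

theorem matched_of_card_eq_one {C : Finset (α × β)} {p : α × β} (hp : p ∈ C)
    (h1 : #{q ∈ C | q.1 = p.1} = 1) (h2 : #{q ∈ C | q.2 = p.2} = 1) :
    Matched (C : Set (α × β)) p.1 p.2 := by
  rw [card_eq_one] at h1 h2
  obtain ⟨x, hx⟩ := h1
  obtain ⟨y, hy⟩ := h2
  simp only [Finset.ext_iff, mem_filter, mem_singleton] at hx hy
  intro q hq
  rw [mem_coe] at hq
  grind

variable [Fintype α] [Fintype β] {C : Finset (α × β)}

/-- The counting bound. A code cell gives total share at most `3` unless it is isolated, and only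
`2` if it is alone on neither of its lines. There is at most one isolated cell, and none if an empty
row and an empty column exist, since these would form a second matched pair. Hence the isolated
cells and the empty lines, counted twice, cost at most `2` more than the number of empty lines. -/
theorem IsLocatingDominating.two_mul_card_add_card_le [Nonempty α] [Nonempty β]
    (hC : (completeProd α β).IsLocatingDominating (C : Set (α × β))) :
    2 * Fintype.card α + 2 * Fintype.card β +
        #{p ∈ C | #{q ∈ C | q.1 = p.1} ≠ 1 ∧ #{q ∈ C | q.2 = p.2} ≠ 1} ≤
      3 * #C + 2 + #{a | #{p ∈ C | p.1 = a} = 0} + #{b | #{p ∈ C | p.2 = b} = 0} := by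
  have h1 := two_mul_card_le_sum_share C (Prod.fst : α × β → α)
  have h2 := two_mul_card_le_sum_share C (Prod.snd : α × β → β)
  have h3 := sum_share_add_sum_share C
  have h4 := hC.card_empty_rows_le
  have h5 := hC.card_empty_cols_le
  have h6 : #{p ∈ C | #{q ∈ C | q.1 = p.1} = 1 ∧ #{q ∈ C | q.2 = p.2} = 1} ≤ 1 := by
    rw [card_le_one]
    intro p hp q hq
    simp only [mem_filter] at hp hq
    have hmp := matched_of_card_eq_one hp.1 hp.2.1 hp.2.2
    have hmq := matched_of_card_eq_one hq.1 hq.2.1 hq.2.2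
    rcases hC.matched hmp hmq with h | h
    · exact Prod.ext h ((hmq p hp.1).1 h)
    · exact Prod.ext ((hmq p hp.1).2 h.symm) h.symm
  by_cases h7 : #{a | #{p ∈ C | p.1 = a} = 0} = 1 ∧ #{b | #{p ∈ C | p.2 = b} = 0} = 1
  · obtain ⟨r, hr⟩ := card_pos.1 (h7.1.symm ▸ Nat.one_pos)
    obtain ⟨c, hc⟩ := card_pos.1 (h7.2.symm ▸ Nat.one_pos)
    have hr := card_fiber_eq_zero.1 (mem_filter.1 hr).2
    have hc := card_fiber_eq_zero.1 (mem_filter.1 hc).2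
    have h8 : #{p ∈ C | #{q ∈ C | q.1 = p.1} = 1 ∧ #{q ∈ C | q.2 = p.2} = 1} = 0 := by
      rw [card_eq_zero, filter_eq_empty_iff]
      rintro p hp ⟨hp1, hp2⟩
      have hrc : Matched (C : Set (α × β)) r c :=
        fun q hq => iff_of_false (hr q hq) (hc q hq)
      rcases hC.matched hrc (matched_of_card_eq_one hp hp1 hp2) with h | h
      · exact hr p hp h.symm
      · exact hc p hp h
    omega
  · omega

/-- Suppose `m - 1 ≤ 3` cells form a code with two rows. Each column has at most one code cell, and
some row has at most one. The cell of the other row in the column of that code cell (or, if the row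
is empty, in an empty column) lies outside the code and is not dominated. -/
theorem IsLocatingDominating.le_card_of_two_rows {m : ℕ} (hm : m ≤ 4)
    {C : Finset (Fin 2 × Fin m)}
    (hC : (completeProd (Fin 2) (Fin m)).IsLocatingDominating (C : Set (Fin 2 × Fin m))) :
    m ≤ #C := by
  by_contra! hlt
  have hdom := (isLocatingDominating_completeProd_iff.1 hC).2.1
  have hcol : ∀ c, #{p ∈ C | p.2 = c} ≤ 1 := by
    intro c
    have h := hC.card_empty_cols_le
    have h1 := card_add_card_fiber_le C Prod.snd c
    rw [Fintype.card_fin] at h1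
    omega
  have hrows := card_eq_sum_card_fiberwise (f := Prod.fst) (t := univ) (s := C) (by simp)
  rw [Fin.sum_univ_two] at hrows
  obtain ⟨r, hr⟩ : ∃ r, #{p ∈ C | p.1 = r} ≤ 1 := by
    by_cases h : #{p ∈ C | p.1 = 0} ≤ 1
    · exact ⟨0, h⟩
    · exact ⟨1, by omega⟩
  -- a cell outside the code, in the other row, whose column contains every code cell of row `r`
  obtain ⟨u, hu, hur, hcov⟩ : ∃ u : Fin 2 × Fin m, u ∉ C ∧ u.1 ≠ r ∧
      ∀ p ∈ C, p.1 = r → p.2 = u.2 := by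
    rcases Nat.le_one_iff_eq_zero_or_eq_one.1 hr with h | h
    · have h' := card_fiber_eq_zero.1 h
      obtain ⟨c, hc⟩ : ∃ c, c ∉ C.image Prod.snd := by
        by_contra! hall
        have := card_image_le (s := C) (f := Prod.snd)
        rw [eq_univ_iff_forall.2 hall, card_univ, Fintype.card_fin] at this
        omega
      exact ⟨(r + 1, c), fun hm => hc (mem_image_of_mem _ hm), by fin_cases r <;> simp,
        fun p hp hpr => absurd hpr (h' p hp)⟩
    · obtain ⟨q, hq⟩ := card_eq_one.1 h
      have hqm : q ∈ C ∧ q.1 = r := mem_filter.1 (hq ▸ mem_singleton_self q)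
      refine ⟨(r + 1, q.2), fun hm => ?_, by fin_cases r <;> simp, fun p hp hpr => ?_⟩
      · have := card_le_one.1 (hcol q.2) _ (mem_filter.2 ⟨hm, rfl⟩) _
          (mem_filter.2 ⟨hqm.1, rfl⟩)
        have := congrArg Prod.fst this
        simp only [hqm.2] at this
        revert this
        fin_cases r <;> simp
      · have : p ∈ ({q} : Finset _) := hq ▸ mem_filter.2 ⟨hp, hpr⟩
        rw [mem_singleton.1 this]
  obtain ⟨p, hp, h1, h2⟩ := hdom u hu
  refine h2 (hcov p hp ?_)
  omega

/-- A code with four cells on the `4 × 4` board would attain equality in the counting bound. It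
would have a row and a column with two code cells each, crossing outside the code, and the crossing
cell would not be dominated. -/
theorem IsLocatingDominating.five_le_card {C : Finset (Fin 4 × Fin 4)}
    (hC : (completeProd (Fin 4) (Fin 4)).IsLocatingDominating (C : Set (Fin 4 × Fin 4))) :
    5 ≤ #C := by
  have hb := hC.two_mul_card_add_card_le
  rw [Fintype.card_fin] at hb
  have hr := hC.card_empty_rows_le
  have hc := hC.card_empty_cols_le
  by_contra! hlt
  have hz : #{p ∈ C | #{q ∈ C | q.1 = p.1} ≠ 1 ∧ #{q ∈ C | q.2 = p.2} ≠ 1} = 0 := by omega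
  rw [card_eq_zero, filter_eq_empty_iff] at hz
  obtain ⟨r, hr⟩ := exists_one_lt_card_fiber (C := C) (f := Prod.fst)
    (by rw [Fintype.card_fin]; omega) (by omega)
  obtain ⟨c, hc⟩ := exists_one_lt_card_fiber (C := C) (f := Prod.snd)
    (by rw [Fintype.card_fin]; omega) (by omega)
  have hrc : (r, c) ∉ C := fun h => hz h ⟨by dsimp only; omega, by dsimp only; omega⟩
  have hdisj : Disjoint {p ∈ C | p.1 = r} {p ∈ C | p.2 = c} := by
    rw [disjoint_filter]
    rintro p hp rfl rfl
    exact hrc hp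
  have hall : {p ∈ C | p.1 = r ∨ p.2 = c} = C := by
    refine eq_of_subset_of_card_le (filter_subset _ _) ?_
    rw [filter_or, card_union_of_disjoint hdisj]
    omega
  obtain ⟨p, hp, h1, h2⟩ := (isLocatingDominating_completeProd_iff.1 hC).2.1 (r, c) hrc
  rw [filter_eq_self] at hall
  exact (hall p hp).elim h1 h2

end LowerBound

/-! ### Constructions -/

section UpperBound

theorem locatingDominationNumber_le {V : Type*} [Fintype V] {G : SimpleGraph V} {C : Finset V}
    (hC : G.IsLocatingDominating (C : Set V)) : G.locatingDominationNumber ≤ #C :=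
  Nat.sInf_le ⟨C, hC, rfl⟩

/-- A code listed as the cells `(f i, g i)` for `i < k`, with rows and columns as natural
numbers. -/
theorem locatingDominationNumber_completeProd_le {n m k : ℕ} (f g : ℕ → ℕ) (hk : 0 < k)
    (hf : ∀ i < k, f i < n) (hg : ∀ i < k, g i < m)
    (hdom : ∀ r c, ∃ i < k, f i ≠ r ∧ g i ≠ c)
    (hrow : ∀ r < n, ∀ r' < n, (∀ i < k, f i ≠ r) → (∀ i < k, f i ≠ r') → r = r')
    (hcol : ∀ c < m, ∀ c' < m, (∀ i < k, g i ≠ c) → (∀ i < k, g i ≠ c') → c = c')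
    (hmatch : ∀ r < n, ∀ r' < n, ∀ c c',
      (∀ i < k, f i = r ↔ g i = c') → (∀ i < k, f i = r' ↔ g i = c) → r = r') :
    (completeProd (Fin n) (Fin m)).locatingDominationNumber ≤ k := by
  let C : Finset (Fin n × Fin m) :=
    univ.image fun i : Fin k => (⟨f i, hf i i.2⟩, ⟨g i, hg i i.2⟩)
  have hC : ∀ i (hi : i < k), ((⟨f i, hf i hi⟩, ⟨g i, hg i hi⟩) : Fin n × Fin m) ∈ (C : Set _) :=
    fun i hi => mem_image_of_mem _ (mem_univ (⟨i, hi⟩ : Fin k))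
  have hcard : #C ≤ k := card_image_le.trans (by simp)
  refine (locatingDominationNumber_le (C := C) ?_).trans hcard
  refine isLocatingDominating_completeProd_of ⟨_, hC 0 hk⟩ ?_ ?_ ?_ ?_
  · intro u _
    obtain ⟨i, hi, h1, h2⟩ := hdom u.1 u.2
    exact ⟨_, hC i hi, fun h => h1 (by rw [← h]), fun h => h2 (by rw [← h])⟩
  · intro r r' h h'
    exact Fin.ext (hrow r r.2 r' r'.2 (fun i hi he => h _ (hC i hi) (Fin.ext he))
      fun i hi he => h' _ (hC i hi) (Fin.ext he))
  · intro r r' h h'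
    exact Fin.ext (hcol r r.2 r' r'.2 (fun i hi he => h _ (hC i hi) (Fin.ext he))
      fun i hi he => h' _ (hC i hi) (Fin.ext he))
  · intro r r' c c' h h'
    refine Or.inl (Fin.ext (hmatch r r.2 r' r'.2 c c' (fun i hi => ?_) fun i hi => ?_))
    · simpa [Fin.ext_iff] using h _ (hC i hi)
    · simpa [Fin.ext_iff] using h' _ (hC i hi)

/-- For `m ≥ 2n`, put one code cell in each column but the last: two in each row but the last,
and the rest in the last row. -/
theorem locatingDominationNumber_le_sub_one {n m : ℕ} (hn : 2 ≤ n) (h : 2 * n ≤ m)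
    (hm : 5 ≤ m) :
    (completeProd (Fin n) (Fin m)).locatingDominationNumber ≤ m - 1 := by
  refine locatingDominationNumber_completeProd_le (fun i => min (i / 2) (n - 1)) id
    (by omega) (by intro i hi; omega) (by intro i hi; simp; omega) ?_ ?_ ?_ ?_
  · intro r c
    by_cases hr : r = 0
    · by_cases hc : c = 2
      · exact ⟨3, by omega, by omega, by simp; omega⟩
      · exact ⟨2, by omega, by omega, by simp; omega⟩
    · by_cases hc : c = 0
      · exact ⟨1, by omega, by omega, by simp; omega⟩
      · exact ⟨0, by omega, by omega, by simp; omega⟩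
  · intro r hr r' hr' h1
    exact absurd (h1 (2 * r) (by omega)) (by omega)
  · intro c hc c' hc' h1 h2
    have := h1 c
    have := h2 c'
    simp only [id] at *
    omega
  · -- a row before the last one has two code cells, so that it is not matched
    have key : ∀ r < n, ∀ c, (∀ i < m - 1, min (i / 2) (n - 1) = r ↔ id i = c) → r = n - 1 := by
      intro r hr c hrc
      by_contra hne
      have h1 := (hrc (2 * r) (by omega)).1 (by omega)
      have h2 := (hrc (2 * r + 1) (by omega)).1 (by omega)
      simp only [id] at h1 h2
      omega
    intro r hr r' hr' c c' h1 h2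
    rw [key r hr _ h1, key r' hr' _ h2]

/-- The star forest code: the first `2a` code cells form `a` pairs sharing a row, the other ones
form pairs sharing a column, except that an odd number of cells leaves the last one isolated.
Three of these pairs make the code dominating. -/
theorem locatingDominationNumber_le_of_stars {n m k a : ℕ} (hk : 5 ≤ k) (ha : 2 * a ≤ k)
    (hn1 : k ≤ n + a) (hn2 : n + a + k % 2 ≤ k + 1)
    (hm1 : a + (k + 1) / 2 ≤ m) (hm2 : m ≤ a + (k + 1) / 2 + 1) :
    (completeProd (Fin n) (Fin m)).locatingDominationNumber ≤ k := by
  refine locatingDominationNumber_completeProd_le (k := k)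
    (fun i => if i < 2 * a then i / 2 else i - a) (fun i => if i < 2 * a then i else a + i / 2)
    (by omega) (by intro i hi; split_ifs <;> omega)
    (by intro i hi; split_ifs <;> omega) ?_ ?_ ?_ ?_
  · -- the cells number `0`, `2`, `4` have distinct rows and distinct columns
    intro r c
    by_contra! h
    have h0 := h 0 (by omega)
    have h2 := h 2 (by omega)
    have h4 := h 4 (by omega)
    split_ifs at h0 h2 h4 <;> omega
  · have key : ∀ r < n, (∀ i < k, (if i < 2 * a then i / 2 else i - a) ≠ r) → k ≤ r + a := by
      intro r hr h
      by_contra hlt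
      by_cases hra : r < a
      · exact h (2 * r) (by omega) (by split_ifs <;> omega)
      · exact h (r + a) (by omega) (by split_ifs <;> omega)
    intro r hr r' hr' h h'
    have := key r hr h
    have := key r' hr' h'
    omega
  · have key : ∀ c < m, (∀ i < k, (if i < 2 * a then i else a + i / 2) ≠ c) →
        a + (k + 1) / 2 ≤ c := by
      intro c hc h
      by_contra hlt
      by_cases hca : c < 2 * a
      · exact h c (by omega) (by split_ifs; omega)
      · exact h (2 * (c - a)) (by omega) (by split_ifs <;> omega)
    intro r hr r' hr' h h'
    have := key r hr h
    have := key r' hr' h'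
    omega
  · -- a matched row is empty or contains the isolated cell, and not both exist
    have key : ∀ r < n, ∀ c, (∀ i < k, (if i < 2 * a then i / 2 else i - a) = r ↔
        (if i < 2 * a then i else a + i / 2) = c) → r + a + k % 2 = k := by
      intro r hr c h
      by_contra hne
      by_cases hra : r < a
      · have h1 := h (2 * r) (by omega)
        have h2 := h (2 * r + 1) (by omega)
        split_ifs at h1 h2 <;> omega
      · have h1 := h (r + a) (by omega)
        by_cases hpar : (r + a) % 2 = 0
        · have h2 := h (r + a + 1) (by omega)
          split_ifs at h1 h2 <;> omega
        · have h2 := h (r + a - 1) (by omega)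
          split_ifs at h1 h2 <;> omega
    intro r hr r' hr' c c' h1 h2
    have := key r hr _ h1
    have := key r' hr' _ h2
    omega

/-- The conditions on a code in a form that can be decided for an explicit list of cells. -/
theorem locatingDominationNumber_le_of_cells {n m : ℕ} (C : Finset (Fin n × Fin m))
    (hne : C.Nonempty) (hdom : ∀ u, u ∈ C ∨ ∃ p ∈ C, p.1 ≠ u.1 ∧ p.2 ≠ u.2)
    (hloc : ∀ u v, u ∈ C ∨ v ∈ C ∨ u = v ∨
      ∃ p ∈ C, ¬ ((p.1 ≠ u.1 ∧ p.2 ≠ u.2) ↔ (p.1 ≠ v.1 ∧ p.2 ≠ v.2))) :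
    (completeProd (Fin n) (Fin m)).locatingDominationNumber ≤ #C :=
  locatingDominationNumber_le (isLocatingDominating_completeProd_iff.2
    ⟨hne, fun u hu => (hdom u).resolve_left hu, fun u v hu hv huv =>
      (((hloc u v).resolve_left hu).resolve_left hv).resolve_left huv⟩)

end UpperBound
end SimpleGraph

/-! ### The location-domination number -/

open SimpleGraph in
theorem mainTheorem5 (n m : ℕ) (hn : 2 ≤ n) (hnm : n ≤ m) :
    (2 * n ≤ m → (n, m) ≠ (2, 4) →
      ((((SimpleGraph.completeGraph (Fin n)).directProd
        (SimpleGraph.completeGraph (Fin m))).locatingDominationNumber : ℕ) : ℤ) = (m : ℤ) - 1) ∧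
    (2 < n → m < 2 * n → (n, m) ≠ (4, 4) →
      ((((SimpleGraph.completeGraph (Fin n)).directProd
        (SimpleGraph.completeGraph (Fin m))).locatingDominationNumber : ℕ) : ℤ) =
          ⌈(2 * (n : ℚ) + 2 * (m : ℚ) - 1) / 3⌉ - 1) ∧
    (n = 2 → m ≤ 4 →
      ((SimpleGraph.completeGraph (Fin n)).directProd
        (SimpleGraph.completeGraph (Fin m))).locatingDominationNumber = m) ∧
    (n = 4 → m = 4 →
      ((SimpleGraph.completeGraph (Fin n)).directProd
        (SimpleGraph.completeGraph (Fin m))).locatingDominationNumber = 5) := by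
  have : Nonempty (Fin n) := ⟨⟨0, by omega⟩⟩
  have : Nonempty (Fin m) := ⟨⟨0, by omega⟩⟩
  obtain ⟨C, hC, hk⟩ := (isLeast_locatingDominationNumber (completeProd (Fin n) (Fin m))).1
  refine ⟨fun h hne => ?_, fun h2 h hne => ?_, ?_, ?_⟩
  · have hlow := hC.card_le_card_add_one
    have hup := locatingDominationNumber_le_sub_one hn h (by simp at hne; omega)
    rw [Fintype.card_fin] at hlow
    rw [← hk] at hup ⊢
    omega
  · have hlow := hC.two_mul_card_add_card_le
    have hrow := hC.card_empty_rows_le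
    have hcol := hC.card_empty_cols_le
    simp only [Fintype.card_fin] at hlow
    have hup : 3 * (completeProd (Fin n) (Fin m)).locatingDominationNumber ≤
        2 * n + 2 * m - 2 := by
      by_cases hbig : 9 ≤ n + m
      · -- the number of stars centred in rows, and the number of code cells, are determined by the
        -- residue of `n + m` modulo `3`
        have hstar := locatingDominationNumber_le_of_stars (n := n) (m := m)
          (k := (2 * n + 2 * m - 2) / 3) (a := (2 * m - n - 1) / 3)
          (by omega) (by omega) (by omega) (by omega) (by omega) (by omega)
        omega
      · have hcases : (n = 3 ∧ m = 3) ∨ (n = 3 ∧ m = 4) ∨ (n = 3 ∧ m = 5) := by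
          simp at hne
          omega
        rcases hcases with ⟨rfl, rfl⟩ | ⟨rfl, rfl⟩ | ⟨rfl, rfl⟩
        · have := locatingDominationNumber_le_of_cells (n := 3) (m := 3)
            {(0, 0), (0, 1), (1, 1)} (by simp) (by decide) (by decide)
          simp at this
          omega
        · have := locatingDominationNumber_le_of_cells (n := 3) (m := 4)
            {(0, 0), (0, 1), (1, 1), (1, 2)} (by simp) (by decide) (by decide)
          simp at this
          omega
        · have := locatingDominationNumber_le_of_cells (n := 3) (m := 5)
            {(0, 0), (0, 1), (1, 2), (1, 3)} (by simp) (by decide) (by decide)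
          simp at this
          omega
    have hceil : ⌈(2 * (n : ℚ) + 2 * (m : ℚ) - 1) / 3⌉ = (#C : ℤ) + 1 := by
      have h1 : 2 * n + 2 * m ≤ 3 * #C + 4 := by omega
      have h2 : 3 * #C + 2 ≤ 2 * n + 2 * m := by omega
      have h1 : 2 * (n : ℚ) + 2 * m ≤ 3 * #C + 4 := by exact_mod_cast h1
      have h2 : 3 * (#C : ℚ) + 2 ≤ 2 * n + 2 * m := by exact_mod_cast h2
      rw [Int.ceil_eq_iff]
      push_cast
      constructor <;> linarith
    rw [hceil, ← hk]
    ring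
  · rintro rfl hm
    have hlow := hC.le_card_of_two_rows hm
    refine le_antisymm ?_ (hk ▸ hlow)
    -- a full row is a code
    interval_cases m
    · exact locatingDominationNumber_le_of_cells {(0, 0), (0, 1)} (by simp) (by decide) (by decide)
    · exact locatingDominationNumber_le_of_cells {(0, 0), (0, 1), (0, 2)}
        (by simp) (by decide) (by decide)
    · exact locatingDominationNumber_le_of_cells {(0, 0), (0, 1), (0, 2), (0, 3)}
        (by simp) (by decide) (by decide)
  · rintro rfl rfl
    exact le_antisymm (locatingDominationNumber_le_of_stars (a := 1) (by omega) (by omega)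
      (by omega) (by omega) (by omega) (by omega)) (hk ▸ hC.five_le_card)
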